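/- Let $(X,d)$ be a metric space, let $p$ be a limit (accumulation) point of $X$, and let $s_1>0$. **Pretangent spaces.** A normalizing sequence is a sequence $\tilde r=(r_n)$ of positive reals with $r_n\to 0$. Sequences $\tilde x=(x_n)$, $\tilde y=(y_n)$ in $X$ are mutually stable w.r.t. $\tilde r$ if the finite limit $\tilde d_{\tilde r}(\tilde x,\tilde y)=\lim_n d(x_n,y_n)/r_n$ exists. A family of sequences is self-stable if any two of its members are mutually stable, and maximal self-stable if moreover every sequence outside it fails to be mutually stable with some member. Let $\tilde X_{p,\tilde r}$ be a maximal self-stable family containing the constant sequence $(p,p,\dots)$. The metric identification $(\Omega_{p,\tilde r},\rho)$ of the pseudometric space $(\tilde X_{p,\tilde r},\tilde d_{\tilde r})$ is called a pretangent space to $X$ at $p$. For a strictly increasing sequence $(n_k)$ put $\tilde r'=(r_{n_k})$ and $\tilde x'=(x_{n_k})$. If $\tilde X_{p,\tilde r'}$ is a maximal self-stable family w.r.t. $\tilde r'$ containing all $\tilde x'$ with $\tilde x\in\tilde X_{p,\tilde r}$, then $\tilde x\mapsto\tilde x'$ induces a distance-preserving map $em':\Omega_{p,\tilde r}\to\Omega_{p,\tilde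 r'}$. The pretangent space $\Omega_{p,\tilde r}$ is tangent if $em'$ is an isometry onto $\Omega_{p,\tilde r'}$ for all such $(n_k)$ and $\tilde X_{p,\tilde r'}$. **The limit condition.** Let $X^{+3}$ be the set of triples $(x,y,z)\in X^3$ with $d(x,z)\ge d(x,y)\ge d(y,z)>0$. For $(x,y,z)\in X^{+3}$ let $\sigma(x,y,z)\in[1,\infty)$ be the unique $s\ge 1$ with $d(x,y)^s+d(y,z)^s=d(x,z)^s$ if $d(x,y)\vee d(y,z)<d(x,z)$, and $\sigma(x,y,z)=\infty$ otherwise. Put $$F(x,y)=\frac{d(x,y)\,(d(x,p)\wedge d(y,p))}{(d(x,p)\vee d(y,p))^2}\ \text{ for }(x,y)\ne(p,p),\qquad F(p,p)=0,$$ $$\Phi(x,y,z)=F(x,y)\vee F(x,z)\vee F(y,z),\qquad \Psi(x,y,z)=\frac{d(x,y)\vee d(y,z)\vee d(x,z)}{d(x,y)\wedge d(y,z)\wedge d(x,z)}.$$ Consider the condition $$\lim_{\substack{x,y,z\to p\\(x,y,z)\in X^{+3}}}\frac{\Psi(x,y,z)}{\Phi(x,y,z)}\left(\frac{\sigma(x,y,z)}{s_1-\sigma(x,y,z)}\right)^2=\infty,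 \tag{3.3}$$ where the squared factor is $1$ if $\sigma(x,y,z)=\infty$ and is $\infty$ if $\sigma(x,y,z)=s_1$. **Corollary 3.4.** Suppose that (3.3) holds for $s_1$, and let $(\Omega_{p,\tilde r},\rho)$ be a pretangent space to $X$ at $p$. Each of the following conditions is sufficient for $(\Omega_{p,\tilde r},\rho)$ to be tangent: (i) there is no isometric embedding of $(\Omega_{p,\tilde r},\rho^{s_1})$ into $\mathbb R$, that is, no $f:\Omega_{p,\tilde r}\to\mathbb R$ with $|f(\alpha)-f(\beta)|=\rho(\alpha,\beta)^{s_1}$ for all $\alpha,\beta$; (ii) $(\Omega_{p,\tilde r},\rho^{s_1})$ is isometric to $\mathbb R$ with its usual metric, that is, there is a surjective such $f$. -/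

import Mathlib

open Filter Topology
open scoped ENNReal

namespace Pretangent

/-- A normalizing sequence: positive real numbers tending to zero. -/
structure NormalizingSequence where
  seq : ℕ → ℝ
  pos : ∀ n, 0 < seq n
  tendsto_zero : Tendsto seq atTop (𝓝 0)

/-- The subsequence `r_{φ 0}, r_{φ 1}, …` of a normalizing sequence. -/
def NormalizingSequence.subseq (r : NormalizingSequence) (φ : ℕ → ℕ) (hφ : StrictMono φ) :
    NormalizingSequence where
  seq := r.seq ∘ φ
  pos := fun n => r.pos (φ n)
  tendsto_zero := r.tendsto_zero.comp hφ.tendsto_atTop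

section Families

variable {X : Type*} [MetricSpace X]

/-- Two sequences are mutually stable with respect to `r` if `d(x_n, y_n) / r_n` has a finite
limit. -/
def MutuallyStable (r : NormalizingSequence) (x y : ℕ → X) : Prop :=
  ∃ L : ℝ, Tendsto (fun n => dist (x n) (y n) / r.seq n) atTop (𝓝 L)

/-- The limit of `d(x_n, y_n) / r_n` (used for mutually stable sequences only). -/
noncomputable def seqDist (r : NormalizingSequence) (x y : ℕ → X) : ℝ :=
  limUnder atTop (fun n => dist (x n) (y n) / r.seq n)

theorem MutuallyStable.tendsto {r : NormalizingSequence} {x y : ℕ → X}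
    (h : MutuallyStable r x y) :
    Tendsto (fun n => dist (x n) (y n) / r.seq n) atTop (𝓝 (seqDist r x y)) :=
  tendsto_nhds_limUnder h

/-- Every two members of the family are mutually stable. -/
def SelfStable (r : NormalizingSequence) (F : Set (ℕ → X)) : Prop :=
  ∀ x ∈ F, ∀ y ∈ F, MutuallyStable r x y

/-- A maximal self-stable family. -/
def MaximalSelfStable (r : NormalizingSequence) (F : Set (ℕ → X)) : Prop :=
  SelfStable r F ∧ ∀ z, z ∉ F → ∃ x ∈ F, ¬ MutuallyStable r x z

/-- A maximal self-stable family of sequences in `X` that contains the constant sequence `p`. -/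
structure Family (p : X) (r : NormalizingSequence) where
  carrier : Set (ℕ → X)
  maximal : MaximalSelfStable r carrier
  const_mem : (fun _ => p) ∈ carrier

variable {p : X} {r : NormalizingSequence}

/-- The members of the family, as a type of its own (it carries the limit pseudometric and not
the topology of pointwise convergence). -/
structure Family.Point (F : Family p r) where
  val : ℕ → X
  mem : val ∈ F.carrier

theorem Family.Point.tendsto {F : Family p r} (x y : F.Point) :
    Tendsto (fun n => dist (x.val n) (y.val n) / r.seq n) atTop
      (𝓝 (seqDist r x.val y.val)) :=
  (F.maximal.1 _ x.mem _ y.mem).tendsto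

/-- The limit pseudometric on a maximal self-stable family. -/
noncomputable instance Family.instPseudoMetricSpacePoint (F : Family p r) :
    PseudoMetricSpace F.Point where
  dist x y := seqDist r x.val y.val
  dist_self x := by
    refine tendsto_nhds_unique (x.tendsto x) ?_
    simp
  dist_comm x y := by
    refine tendsto_nhds_unique (x.tendsto y) ?_
    simpa only [dist_comm] using y.tendsto x
  dist_triangle x y z := by
    refine le_of_tendsto_of_tendsto' (x.tendsto z) ((x.tendsto y).add (y.tendsto z)) ?_
    intro n
    rw [← add_div]
    exact div_le_div_of_nonneg_right (dist_triangle _ _ _) (r.pos n).le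

theorem Family.dist_point (F : Family p r) (x y : F.Point) :
    dist x y = seqDist r x.val y.val := rfl

/-- The pretangent space of a maximal self-stable family: its metric identification, that is,
the metric space of classes of points at distance zero. -/
abbrev Family.Space (F : Family p r) : Type _ := SeparationQuotient F.Point

/-- The map `x ↦ x'` (passage to the subsequence `φ`) between maximal self-stable families. -/
def Family.inMap (F : Family p r) {φ : ℕ → ℕ} {hφ : StrictMono φ}
    (F' : Family p (r.subseq φ hφ)) (h : ∀ x ∈ F.carrier, x ∘ φ ∈ F'.carrier)
    (x : F.Point) : F'.Point :=
  ⟨x.val ∘ φ, h x.val x.mem⟩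

theorem Family.isometry_inMap (F : Family p r) {φ : ℕ → ℕ} {hφ : StrictMono φ}
    (F' : Family p (r.subseq φ hφ)) (h : ∀ x ∈ F.carrier, x ∘ φ ∈ F'.carrier) :
    Isometry (F.inMap F' h) := by
  refine Isometry.of_dist_eq fun x y => ?_
  exact tendsto_nhds_unique ((F.inMap F' h x).tendsto (F.inMap F' h y))
    ((x.tendsto y).comp hφ.tendsto_atTop)

/-- The map between pretangent spaces induced by passing to the subsequence `φ`. -/
noncomputable def Family.emMap (F : Family p r) {φ : ℕ → ℕ} {hφ : StrictMono φ}
    (F' : Family p (r.subseq φ hφ)) (h : ∀ x ∈ F.carrier, x ∘ φ ∈ F'.carrier) :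
    F.Space → F'.Space :=
  SeparationQuotient.lift (fun x => SeparationQuotient.mk (F.inMap F' h x)) fun _ _ hxy =>
    SeparationQuotient.mk_eq_mk.2 (hxy.map (F.isometry_inMap F' h).continuous)

/-- A pretangent space is tangent if, for every subsequence and every maximal self-stable family
along it that contains all `x'`, the induced map is an isometry onto. -/
def Family.IsTangent (F : Family p r) : Prop :=
  ∀ (φ : ℕ → ℕ) (hφ : StrictMono φ) (F' : Family p (r.subseq φ hφ))
    (h : ∀ x ∈ F.carrier, x ∘ φ ∈ F'.carrier),
    Isometry (F.emMap F' h) ∧ Function.Surjective (F.emMap F' h)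

end Families

section Betweenness

/-- If `a, b < c ≤ a + b` with `a, b > 0`, then `a ^ s + b ^ s = c ^ s` has exactly one solution
`s ∈ [1, ∞)`. -/
theorem existsUnique_exponent {a b c : ℝ} (ha : 0 < a) (hb : 0 < b) (hac : a < c) (hbc : b < c)
    (habc : c ≤ a + b) : ∃! s : ℝ, 1 ≤ s ∧ a ^ s + b ^ s = c ^ s := by
  have hc : 0 < c := ha.trans hac
  have hu0 : 0 < a / c := div_pos ha hc
  have hv0 : 0 < b / c := div_pos hb hc
  have hu1 : a / c < 1 := (div_lt_one hc).2 hac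
  have hv1 : b / c < 1 := (div_lt_one hc).2 hbc
  have key : ∀ s : ℝ, a ^ s + b ^ s = c ^ s ↔ (a / c) ^ s + (b / c) ^ s = 1 := by
    intro s
    have hcs : 0 < c ^ s := Real.rpow_pos_of_pos hc s
    rw [Real.div_rpow ha.le hc.le, Real.div_rpow hb.le hc.le, ← add_div, div_eq_one_iff_eq hcs.ne']
  have hanti : StrictAnti fun s : ℝ => (a / c) ^ s + (b / c) ^ s := fun s t hst =>
    add_lt_add (Real.rpow_lt_rpow_of_exponent_gt hu0 hu1 hst)
      (Real.rpow_lt_rpow_of_exponent_gt hv0 hv1 hst)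
  have hcont : Continuous fun s : ℝ => (a / c) ^ s + (b / c) ^ s :=
    (Real.continuous_const_rpow hu0.ne').add (Real.continuous_const_rpow hv0.ne')
  have hlim : Tendsto (fun s : ℝ => (a / c) ^ s + (b / c) ^ s) atTop (𝓝 (0 + 0)) :=
    (tendsto_rpow_atTop_of_base_lt_one _ (by linarith) hu1).add
      (tendsto_rpow_atTop_of_base_lt_one _ (by linarith) hv1)
  obtain ⟨t, ht, ht1⟩ := ((hlim.eventually (gt_mem_nhds (by norm_num : (0 : ℝ) + 0 < 1))).and
    (eventually_ge_atTop (1 : ℝ))).exists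
  have h1 : 1 ≤ (a / c) ^ (1 : ℝ) + (b / c) ^ (1 : ℝ) := by
    rw [Real.rpow_one, Real.rpow_one, ← add_div]
    exact (one_le_div hc).2 habc
  obtain ⟨s, hs, hs'⟩ := intermediate_value_Icc' ht1 hcont.continuousOn ⟨ht.le, h1⟩
  refine ⟨s, ⟨hs.1, (key s).2 hs'⟩, ?_⟩
  rintro s₂ ⟨-, h₂⟩
  exact hanti.injective (((key s₂).1 h₂).trans hs'.symm)

variable {X : Type*} [MetricSpace X]

theorem existsUnique_exponent_dist {x y z : X} (h : max (dist x z) (dist z y) < dist x y) :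
    ∃! s : ℝ, 1 ≤ s ∧ dist x z ^ s + dist z y ^ s = dist x y ^ s := by
  obtain ⟨h1, h2⟩ := max_lt_iff.1 h
  refine existsUnique_exponent ?_ ?_ h1 h2 (dist_triangle _ _ _)
  · refine dist_pos.2 ?_
    rintro rfl
    exact lt_irrefl _ h2
  · refine dist_pos.2 ?_
    rintro rfl
    exact lt_irrefl _ h1

open Classical in
/-- `sExp x y z ∈ [1, ∞]` is the unique root `s ∈ [1, ∞)` of
`d(x,z)^s + d(z,y)^s = d(x,y)^s` if `max (d(x,z)) (d(z,y)) < d(x,y)`, and `∞` otherwise.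
Note that the third argument is the intermediate point. -/
noncomputable def sExp (x y z : X) : ℝ≥0∞ :=
  if h : max (dist x z) (dist z y) < dist x y then
    ENNReal.ofReal (Classical.choose (existsUnique_exponent_dist h).exists)
  else ⊤

/-- The set `X^{+3}` of triples with `d(x,z) ≥ d(x,y) ≥ d(y,z) > 0`. -/
def orderedTriples (X : Type*) [MetricSpace X] : Set (X × X × X) :=
  {t | dist t.1 t.2.2 ≥ dist t.1 t.2.1 ∧ dist t.1 t.2.1 ≥ dist t.2.1 t.2.2 ∧
    dist t.2.1 t.2.2 > 0}

open Classical in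
/-- `F(x,y) = d(x,y) min(d(x,p), d(y,p)) / max(d(x,p), d(y,p))²`, and `F(p,p) = 0`. -/
noncomputable def Ffun (p x y : X) : ℝ :=
  if (x, y) = (p, p) then 0
  else dist x y * min (dist x p) (dist y p) / max (dist x p) (dist y p) ^ 2

noncomputable def Phi (p x y z : X) : ℝ :=
  max (max (Ffun p x y) (Ffun p x z)) (Ffun p y z)

open Classical in
/-- The ratio of the largest and the smallest distance of a triple (`∞` if the smallest is `0`). -/
noncomputable def Psi (x y z : X) : ℝ≥0∞ :=
  if min (min (dist x y) (dist y z)) (dist z x) = 0 then ⊤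
  else ENNReal.ofReal
    (max (max (dist x y) (dist y z)) (dist x z) / min (min (dist x y) (dist y z)) (dist z x))

open Classical in
/-- `s² / (s₁ - s)²` in `[0, ∞]`, with the value `1` for `s = ∞` (and `∞` for `s = s₁ > 0`). -/
noncomputable def sqRatio (s₁ : ℝ) (s : ℝ≥0∞) : ℝ≥0∞ :=
  if s = ⊤ then 1
  else ENNReal.ofReal (s.toReal ^ 2) / ENNReal.ofReal ((s₁ - s.toReal) ^ 2)

/-- The limit relation
`lim Ψ(x,y,z) s(x,z,y)² / (Φ(x,y,z) (s₁ - s(x,z,y))²) = ∞` as `x, y, z → p` within `X^{+3}`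
(with `1 / 0 = ∞`). For a triple in `X^{+3}` the longest side is `xz`, so that the exponent is
the one of `y` relative to the pair `x, z`. -/
def LimitRelation (p : X) (s₁ : ℝ) : Prop :=
  Tendsto
    (fun t : X × X × X =>
      Psi t.1 t.2.1 t.2.2 * sqRatio s₁ (sExp t.1 t.2.2 t.2.1) /
        ENNReal.ofReal (Phi p t.1 t.2.1 t.2.2))
    (𝓝[orderedTriples X] (p, p, p)) (𝓝 ⊤)

/-- `f` is distance-preserving from `(Y, ρ^s)` to the real line with its usual metric. -/
def PowIsometry {Y : Type*} [MetricSpace Y] (s : ℝ) (f : Y → ℝ) : Prop :=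
  ∀ a b : Y, |f a - f b| = dist a b ^ s

end Betweenness

end Pretangent

/-!
The functions `Ffun`, `Phi` and `Psi` are homogeneous of degree zero, so along sequences of a family
they converge to the values of the same functions on the pretangent space. At three distinct points
these values are finite and positive, so the limit relation forces the exponent of an ordered triple
to tend to `s₁`; passing to the limit in the equation that defines the exponent, all triples of
`(Ω, ρ ^ s₁)` are linear. By Menger's theorem such a space embeds into the line or has exactly four
points, and this applies to the pretangent space `Ω'` along any subsequence as well. If `Ω` does not
embed, neither does `Ω'`, and `Ω → Ω'` is an injection between sets of four points. If `Ω` is the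
line, then `Ω'` is infinite, hence embeds into the line, and the composite `ℝ ≃ Ω → Ω' → ℝ` is an
isometry of the line into itself, which is onto.
-/

namespace Pretangent

section Menger

variable {Y : Type*} {D : Y → Y → ℝ}

/-- A semimetric: a distance function for which the triangle inequality is not required. The power
`ρ ^ s` of a metric is a semimetric for all `s > 0`, but need not be a metric if `s > 1`. -/
structure IsSemimetric (D : Y → Y → ℝ) : Prop where
  nonneg : ∀ a b, 0 ≤ D a b
  comm : ∀ a b, D a b = D b a
  eq_zero_iff : ∀ {a b}, D a b = 0 ↔ a = b

/-- Three points whose distances, given by `D`, are those of three points of the line. The three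
cases say that the point in the middle is `b`, `c`, `a`, respectively. -/
def IsLinearTriple (D : Y → Y → ℝ) (a b c : Y) : Prop :=
  D a b + D b c = D a c ∨ D a c + D c b = D a b ∨ D b a + D a c = D b c

/-- A coordinate with respect to two base points: `f` places every point on the line at the correct
distances from `o`, which is placed at `0`, and from `e`, which is placed at `D o e`. -/
structure IsCoordinate (D : Y → Y → ℝ) (o e : Y) (f : Y → ℝ) : Prop where
  abs_eq : ∀ x, |f x| = D o x
  abs_sub_eq : ∀ x, |f x - D o e| = D e x

namespace IsSemimetric

variable {a b o : Y}

theorem apply_self (hD : IsSemimetric D) (a : Y) : D a a = 0 :=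
  hD.eq_zero_iff.2 rfl

theorem isLinearTriple_self_left (hD : IsSemimetric D) (a b : Y) : IsLinearTriple D a a b :=
  .inl (by rw [hD.apply_self, zero_add])

theorem eq_abs_sub_or_eq_abs_add (hD : IsSemimetric D) (h : IsLinearTriple D o a b) {u v : ℝ}
    (hu : |u| = D o a) (hv : |v| = D o b) : D a b = |u - v| ∨ D a b = |u + v| := by
  have hab := hD.nonneg a b
  rw [IsLinearTriple, hD.comm b a, hD.comm a o, ← hu, ← hv] at h
  grind

theorem exists_isCoordinate (hD : IsSemimetric D) (hlin : ∀ a b c, IsLinearTriple D a b c)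
    (o e : Y) : ∃ f, IsCoordinate D o e f := by
  have exists_value (x : Y) : ∃ u : ℝ, |u| = D o x ∧ |u - D o e| = D e x := by
    have hox := hD.nonneg o x
    have hex := hD.nonneg e x
    have hoe := hD.nonneg o e
    rcases hlin o e x with h | h | h
    · exact ⟨D o x, abs_of_nonneg hox, by grind⟩
    · rw [hD.comm x e] at h
      exact ⟨D o x, abs_of_nonneg hox, by grind⟩
    · rw [hD.comm e o] at h
      exact ⟨-D o x, by grind, by grind⟩
  choose f hfo hfe using exists_value
  exact ⟨f, hfo, hfe⟩

end IsSemimetric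

namespace IsLinearTriple

variable {a b c : Y}

theorem swap_left (h : IsLinearTriple D a b c) (hD : IsSemimetric D) :
    IsLinearTriple D b a c := by
  rw [IsLinearTriple] at *
  grind [hD.comm a b, hD.comm b c, hD.comm a c]

theorem swap_right (h : IsLinearTriple D a b c) (hD : IsSemimetric D) :
    IsLinearTriple D a c b := by
  rw [IsLinearTriple] at *
  grind [hD.comm a b, hD.comm b c, hD.comm a c]

end IsLinearTriple

namespace IsCoordinate

variable {o e x y : Y} {f : Y → ℝ}

theorem eq_zero_iff (hf : IsCoordinate D o e f) (hD : IsSemimetric D) : f x = 0 ↔ x = o := by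
  rw [← abs_eq_zero, hf.abs_eq, hD.eq_zero_iff, eq_comm]

theorem eq_dist_iff (hf : IsCoordinate D o e f) (hD : IsSemimetric D) :
    f x = D o e ↔ x = e := by
  rw [← sub_eq_zero, ← abs_eq_zero, hf.abs_sub_eq, hD.eq_zero_iff, eq_comm]

theorem abs_sub_eq_or (hf : IsCoordinate D o e f) (hD : IsSemimetric D)
    (hlin : ∀ a b c, IsLinearTriple D a b c) (hoe : o ≠ e) (a b : Y) :
    |f a - f b| = D a b ∨ f a + f b = D o e ∧ D a b = D o e := by
  have hc : D o e ≠ 0 := hD.eq_zero_iff.not.2 hoe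
  rcases hD.eq_abs_sub_or_eq_abs_add (hlin o a b) (hf.abs_eq a) (hf.abs_eq b) with ho | ho
  · exact .inl ho.symm
  rcases hD.eq_abs_sub_or_eq_abs_add (hlin e a b) (hf.abs_sub_eq a) (hf.abs_sub_eq b) with he | he
  · exact .inl (by rw [he, sub_sub_sub_cancel_right])
  have hsum : f a + f b = D o e := by
    rcases abs_eq_abs.1 (ho.symm.trans he) with h | h
    · exact absurd (by linarith) hc
    · linarith
  exact .inr ⟨hsum, by rw [ho, hsum, abs_of_nonneg (hD.nonneg o e)]⟩

theorem eq_or_eq_of_abs_sub_ne (hf : IsCoordinate D o e f) (hD : IsSemimetric D)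
    (hlin : ∀ a b c, IsLinearTriple D a b c) (hoe : o ≠ e) (hxy : |f x - f y| ≠ D x y) (w : Y) :
    w = o ∨ w = e ∨ w = x ∨ w = y := by
  have eq_of_abs_sub {z : Y} (h : |f w - f z| = D w z) (hz : f w = f z) : w = z :=
    hD.eq_zero_iff.1 (by rw [← h, hz, sub_self, abs_zero])
  obtain ⟨hsum, hdist⟩ := (hf.abs_sub_eq_or hD hlin hoe x y).resolve_left hxy
  rcases hf.abs_sub_eq_or hD hlin hoe w x with hx | ⟨hwx, hDx⟩ <;>
    rcases hf.abs_sub_eq_or hD hlin hoe w y with hy | ⟨hwy, hDy⟩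
  · rcases hD.eq_abs_sub_or_eq_abs_add (hlin w x y) hx hy with h | h
    · rw [sub_sub_sub_cancel_left, abs_sub_comm] at h
      exact absurd h.symm hxy
    rw [hdist] at h
    rcases (_root_.abs_eq (hD.nonneg o e)).1 h.symm with h | h
    · exact .inr (.inl ((hf.eq_dist_iff hD).1 (by linarith)))
    · exact .inl ((hf.eq_zero_iff hD).1 (by linarith))
  · exact .inr (.inr (.inl (eq_of_abs_sub hx (by linarith))))
  · exact .inr (.inr (.inr (eq_of_abs_sub hy (by linarith))))
  · -- The triple `w, x, y` is equilateral, hence not linear.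
    have hpos : 0 < D o e := (hD.nonneg o e).lt_of_ne' (hD.eq_zero_iff.not.2 hoe)
    have h := hlin w x y
    rw [IsLinearTriple, hD.comm y x, hD.comm x w, hDx, hDy, hdist] at h
    grind

theorem card_eq_four_of_abs_sub_ne (hf : IsCoordinate D o e f) (hD : IsSemimetric D)
    (hlin : ∀ a b c, IsLinearTriple D a b c) (hoe : o ≠ e) (hxy : |f x - f y| ≠ D x y) :
    Nat.card Y = 4 := by
  classical
  have abs_sub_left (z : Y) : |f o - f z| = D o z := by
    rw [(hf.eq_zero_iff hD).2 rfl, zero_sub, abs_neg, hf.abs_eq]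
  have abs_sub_right (z : Y) : |f e - f z| = D e z := by
    rw [(hf.eq_dist_iff hD).2 rfl, abs_sub_comm, hf.abs_sub_eq]
  have hox : o ≠ x := by
    rintro rfl
    exact hxy (abs_sub_left y)
  have hex : e ≠ x := by
    rintro rfl
    exact hxy (abs_sub_right y)
  have hoy : o ≠ y := by
    rintro rfl
    exact hxy (by rw [abs_sub_comm, abs_sub_left, hD.comm])
  have hey : e ≠ y := by
    rintro rfl
    exact hxy (by rw [abs_sub_comm, abs_sub_right, hD.comm])
  have hne : x ≠ y := by
    rintro rfl
    exact hxy (by rw [sub_self, abs_zero, hD.apply_self])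
  have huniv : (Set.univ : Set Y) = ({o, e, x, y} : Finset Y) := by
    ext w
    simpa using hf.eq_or_eq_of_abs_sub_ne hD hlin hoe hxy w
  rw [← Set.ncard_univ, huniv, Set.ncard_coe_finset]
  simp [*]

end IsCoordinate

/-- **Menger's theorem** for the line. -/
theorem IsSemimetric.exists_abs_sub_eq_or_card_eq_four (hD : IsSemimetric D)
    (hlin : ∀ a b c, IsLinearTriple D a b c) :
    (∃ f : Y → ℝ, ∀ a b, |f a - f b| = D a b) ∨ Nat.card Y = 4 := by
  rcases subsingleton_or_nontrivial Y with _ | _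
  · exact .inl ⟨0, fun a b => by
      rw [Subsingleton.elim a b, hD.apply_self, sub_self, abs_zero]⟩
  obtain ⟨o, e, hoe⟩ := exists_pair_ne Y
  obtain ⟨f, hf⟩ := hD.exists_isCoordinate hlin o e
  by_cases hiso : ∀ a b, |f a - f b| = D a b
  · exact .inl ⟨f, hiso⟩
  · push Not at hiso
    obtain ⟨x, y, hxy⟩ := hiso
    exact .inr (hf.card_eq_four_of_abs_sub_ne hD hlin hoe hxy)

theorem isSemimetric_dist_rpow {Y : Type*} [MetricSpace Y] {s : ℝ} (hs : 0 < s) :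
    IsSemimetric fun a b : Y => dist a b ^ s where
  nonneg _ _ := Real.rpow_nonneg dist_nonneg s
  comm a b := by rw [dist_comm]
  eq_zero_iff {a b} := by rw [Real.rpow_eq_zero dist_nonneg hs.ne', dist_eq_zero]

end Menger

section PowIsometry

theorem surjective_of_isometry_of_finrank_eq {E G : Type*} [NormedAddCommGroup E]
    [NormedSpace ℝ E] [FiniteDimensional ℝ E] [NormedAddCommGroup G] [NormedSpace ℝ G]
    [FiniteDimensional ℝ G] [StrictConvexSpace ℝ G]
    (hfinrank : Module.finrank ℝ E = Module.finrank ℝ G) {f : E → G} (hf : Isometry f) :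
    Function.Surjective f :=
  have : Inhabited E := ⟨0⟩
  (hf.affineIsometryOfStrictConvexSpace.toAffineIsometryEquiv hfinrank).surjective

namespace PowIsometry

variable {Y Z : Type*} [MetricSpace Y] [MetricSpace Z] {s : ℝ}

theorem comp_isometry {f : Z → ℝ} (hf : PowIsometry s f) {g : Y → Z} (hg : Isometry g) :
    PowIsometry s (f ∘ g) :=
  fun a b => by rw [Function.comp, Function.comp, hf, hg.dist_eq]

theorem injective {f : Y → ℝ} (hf : PowIsometry s f) (hs : 0 < s) : Function.Injective f :=
  fun a b hab => by
    rw [← (isSemimetric_dist_rpow hs).eq_zero_iff, ← hf, hab, sub_self, abs_zero]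

theorem surjective_of_surjective {f g : Y → ℝ} (hf : PowIsometry s f) (hg : PowIsometry s g)
    (hsurj : Function.Surjective f) : Function.Surjective g := by
  obtain ⟨k, hk⟩ := hsurj.hasRightInverse
  have hiso : Isometry (g ∘ k) := Isometry.of_dist_eq fun a b => by
    rw [Real.dist_eq, Real.dist_eq, Function.comp, Function.comp, hg, ← hf, hk, hk]
  exact (surjective_of_isometry_of_finrank_eq rfl hiso).of_comp

end PowIsometry

end PowIsometry

section TripleFunctions

variable {X : Type*} [MetricSpace X] {x y z p : X}

theorem sExp_rpow_add_rpow (h : sExp x y z ≠ ⊤) :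
    dist x z ^ (sExp x y z).toReal + dist z y ^ (sExp x y z).toReal
      = dist x y ^ (sExp x y z).toReal := by
  unfold sExp at h ⊢
  split_ifs at h ⊢ with hlt
  · obtain ⟨hone, heq⟩ := Classical.choose_spec (existsUnique_exponent_dist hlt).exists
    rwa [ENNReal.toReal_ofReal (zero_le_one.trans hone)]
  · exact absurd rfl h

theorem Ffun_eq (p x y : X) :
    Ffun p x y = dist x y * min (dist x p) (dist y p) / max (dist x p) (dist y p) ^ 2 := by
  unfold Ffun
  split_ifs with h
  · obtain ⟨rfl, rfl⟩ := Prod.mk.inj h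
    simp
  · rfl

theorem Ffun_pos (hxy : x ≠ y) (hx : x ≠ p) (hy : y ≠ p) : 0 < Ffun p x y := by
  have hmin : 0 < min (dist x p) (dist y p) := lt_min (dist_pos.2 hx) (dist_pos.2 hy)
  have hmax : 0 < max (dist x p) (dist y p) := lt_max_of_lt_left (dist_pos.2 hx)
  have hdist : 0 < dist x y := dist_pos.2 hxy
  rw [Ffun_eq]
  positivity

theorem Ffun_eq_div {ρ : ℝ} (hρ : 0 < ρ) (p x y : X) :
    Ffun p x y = dist x y / ρ * min (dist x p / ρ) (dist y p / ρ) /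
      max (dist x p / ρ) (dist y p / ρ) ^ 2 := by
  rw [Ffun_eq, min_div_div_right hρ.le, max_div_div_right hρ.le]
  field_simp

theorem Phi_pos (hxy : x ≠ y) (hyz : y ≠ z) (hxz : x ≠ z) : 0 < Phi p x y z := by
  -- At most one of the three points is equal to `p`.
  by_cases hx : x = p
  · exact lt_max_of_lt_right (Ffun_pos hyz (hx ▸ hxy.symm) (hx ▸ hxz.symm))
  by_cases hy : y = p
  · exact lt_max_of_lt_left (lt_max_of_lt_right (Ffun_pos hxz hx (hy ▸ hyz.symm)))
  · exact lt_max_of_lt_left (lt_max_of_lt_left (Ffun_pos hxy hx hy))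

theorem min_dist_pos (hxy : x ≠ y) (hyz : y ≠ z) (hxz : x ≠ z) :
    0 < min (min (dist x y) (dist y z)) (dist z x) :=
  lt_min (lt_min (dist_pos.2 hxy) (dist_pos.2 hyz)) (dist_pos.2 hxz.symm)

theorem Psi_eq_ofReal (hxy : x ≠ y) (hyz : y ≠ z) (hxz : x ≠ z) :
    Psi x y z = ENNReal.ofReal (max (max (dist x y) (dist y z)) (dist x z) /
      min (min (dist x y) (dist y z)) (dist z x)) :=
  if_neg (min_dist_pos hxy hyz hxz).ne'

theorem Psi_ne_top (hxy : x ≠ y) (hyz : y ≠ z) (hxz : x ≠ z) : Psi x y z ≠ ⊤ := by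
  rw [Psi_eq_ofReal hxy hyz hxz]
  exact ENNReal.ofReal_ne_top

theorem mul_abs_sub_lt_of_lt_sqRatio {s₁ M : ℝ} {σ : ℝ≥0∞} (hM : 0 ≤ M) (hσ : σ ≠ ⊤)
    (h : ENNReal.ofReal (M ^ 2) < sqRatio s₁ σ) : M * |s₁ - σ.toReal| < σ.toReal := by
  rw [sqRatio, if_neg hσ] at h
  have hmul := ENNReal.mul_lt_of_lt_div h
  rw [← ENNReal.ofReal_mul (sq_nonneg M), ← mul_pow] at hmul
  have hsq := (ENNReal.ofReal_lt_ofReal_iff').1 hmul |>.1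
  simpa only [abs_mul, abs_of_nonneg hM] using abs_lt_of_sq_lt_sq hsq ENNReal.toReal_nonneg

theorem tendsto_top_of_tendsto_mul_div {ι : Type*} {l : Filter ι} {a b s : ι → ℝ≥0∞}
    {A B : ℝ≥0∞} (h : Tendsto (fun i => a i * s i / b i) l (𝓝 ⊤)) (ha : Tendsto a l (𝓝 A))
    (hA : A ≠ ⊤) (hb : Tendsto b l (𝓝 B)) (hB : B ≠ 0) : Tendsto s l (𝓝 ⊤) := by
  have hBA : B / A ≠ 0 := (ENNReal.div_pos hB hA).ne'
  have hmul := ENNReal.Tendsto.mul h (.inl ENNReal.top_ne_zero)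
    (ENNReal.Tendsto.div hb (.inl hB) ha (.inl hA)) (.inl hBA)
  rw [ENNReal.top_mul hBA] at hmul
  refine hmul.congr' ?_
  filter_upwards [h.eventually_ne ENNReal.top_ne_zero, ha.eventually_ne hA, hb.eventually_ne hB]
    with i hi ha_top hb_zero
  obtain ⟨hprod, hb_top⟩ := ENNReal.div_ne_zero.1 hi
  have ha_zero : a i ≠ 0 := left_ne_zero_of_mul hprod
  rw [mul_comm (a i), mul_div_assoc, mul_assoc, ← mul_div_assoc,
    ENNReal.div_mul_cancel hb_zero hb_top, ENNReal.div_self ha_zero ha_top, mul_one]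

theorem eventually_ne_top_of_tendsto_sqRatio {ι : Type*} {l : Filter ι} {s₁ : ℝ} {σ : ι → ℝ≥0∞}
    (h : Tendsto (fun i => sqRatio s₁ (σ i)) l (𝓝 ⊤)) : ∀ᶠ i in l, σ i ≠ ⊤ := by
  filter_upwards [h.eventually (lt_mem_nhds ENNReal.one_lt_top)] with i hi htop
  rw [sqRatio, if_pos htop] at hi
  exact lt_irrefl _ hi

theorem tendsto_toReal_of_tendsto_sqRatio {ι : Type*} {l : Filter ι} {s₁ : ℝ} {σ : ι → ℝ≥0∞}
    (h : Tendsto (fun i => sqRatio s₁ (σ i)) l (𝓝 ⊤)) :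
    Tendsto (fun i => (σ i).toReal) l (𝓝 s₁) := by
  refine Metric.tendsto_nhds.2 fun ε hε => ?_
  have hM : 0 ≤ 1 + |s₁| / ε := by positivity
  filter_upwards [eventually_ne_top_of_tendsto_sqRatio h,
    h.eventually (lt_mem_nhds (ENNReal.ofReal_lt_top (r := (1 + |s₁| / ε) ^ 2)))] with i hfin hlt
  have hlt' : (1 + |s₁| / ε) * |s₁ - (σ i).toReal| < (σ i).toReal :=
    mul_abs_sub_lt_of_lt_sqRatio hM hfin hlt
  have hle : (σ i).toReal ≤ |s₁| + |s₁ - (σ i).toReal| := by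
    linarith [le_abs_self s₁, neg_abs_le (s₁ - (σ i).toReal)]
  have hmul : |s₁| * |s₁ - (σ i).toReal| < |s₁| * ε := by
    rw [← div_lt_iff₀ hε, mul_div_right_comm]
    linarith
  rw [Real.dist_eq, abs_sub_comm]
  exact lt_of_mul_lt_mul_left hmul (abs_nonneg s₁)

theorem exists_perm_mem_orderedTriples (hxy : x ≠ y) (hyz : y ≠ z) (hxz : x ≠ z) :
    (x, y, z) ∈ orderedTriples X ∨ (x, z, y) ∈ orderedTriples X ∨
    (y, x, z) ∈ orderedTriples X ∨ (y, z, x) ∈ orderedTriples X ∨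
    (z, x, y) ∈ orderedTriples X ∨ (z, y, x) ∈ orderedTriples X := by
  simp only [orderedTriples, Set.mem_ofPred_eq, dist_comm y x, dist_comm z x, dist_comm z y,
    ge_iff_le, gt_iff_lt, dist_pos.2 hxy, dist_pos.2 hyz, dist_pos.2 hxz, and_true]
  grind

end TripleFunctions

section Convergence

variable {X : Type*} [MetricSpace X] {p : X} {r : NormalizingSequence} {F : Family p r}

/-- The constant sequence `p`, which represents the distinguished point of the pretangent space. -/
def Family.base (F : Family p r) : F.Point := ⟨fun _ => p, F.const_mem⟩

/-- The point of the pretangent space that a sequence of the family represents. -/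
noncomputable abbrev Family.Point.toSpace (x : F.Point) : F.Space := SeparationQuotient.mk x

namespace Family.Point

variable {x y z : F.Point}

theorem tendsto_dist (x y : F.Point) :
    Tendsto (fun n => dist (x.val n) (y.val n) / r.seq n) atTop (𝓝 (dist x.toSpace y.toSpace)) :=
  x.tendsto y

theorem tendsto_dist_base (x : F.Point) :
    Tendsto (fun n => dist (x.val n) p / r.seq n) atTop (𝓝 (dist x.toSpace F.base.toSpace)) :=
  x.tendsto F.base

theorem tendsto_val (x : F.Point) : Tendsto x.val atTop (𝓝 p) := by
  have hmul := x.tendsto_dist_base.mul r.tendsto_zero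
  rw [mul_zero] at hmul
  exact tendsto_iff_dist_tendsto_zero.2 <|
    hmul.congr fun n => div_mul_cancel₀ _ (r.pos n).ne'

theorem eventually_val_ne (hxy : x.toSpace ≠ y.toSpace) : ∀ᶠ n in atTop, x.val n ≠ y.val n := by
  filter_upwards [(x.tendsto_dist y).eventually (lt_mem_nhds (dist_pos.2 hxy))] with n hn heq
  simp [heq] at hn

theorem tendsto_Ffun (hxy : x.toSpace ≠ y.toSpace) :
    Tendsto (fun n => Ffun p (x.val n) (y.val n)) atTop
      (𝓝 (Ffun F.base.toSpace x.toSpace y.toSpace)) := by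
  have hmax : 0 < max (dist x.toSpace F.base.toSpace) (dist y.toSpace F.base.toSpace) := by
    by_contra! hle
    obtain ⟨hx, hy⟩ := max_le_iff.1 hle
    exact hxy ((dist_le_zero.1 hx).trans (dist_le_zero.1 hy).symm)
  rw [Ffun_eq]
  exact (((x.tendsto_dist y).mul (x.tendsto_dist_base.min y.tendsto_dist_base)).div
    ((x.tendsto_dist_base.max y.tendsto_dist_base).pow 2) (by positivity)).congr
      fun n => (Ffun_eq_div (r.pos n) p (x.val n) (y.val n)).symm

theorem tendsto_Phi (hxy : x.toSpace ≠ y.toSpace) (hyz : y.toSpace ≠ z.toSpace)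
    (hxz : x.toSpace ≠ z.toSpace) :
    Tendsto (fun n => Phi p (x.val n) (y.val n) (z.val n)) atTop
      (𝓝 (Phi F.base.toSpace x.toSpace y.toSpace z.toSpace)) :=
  ((tendsto_Ffun hxy).max (tendsto_Ffun hxz)).max (tendsto_Ffun hyz)

theorem tendsto_Psi (hxy : x.toSpace ≠ y.toSpace) (hyz : y.toSpace ≠ z.toSpace)
    (hxz : x.toSpace ≠ z.toSpace) :
    Tendsto (fun n => Psi (x.val n) (y.val n) (z.val n)) atTop
      (𝓝 (Psi x.toSpace y.toSpace z.toSpace)) := by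
  have hquot :=
    (((x.tendsto_dist y).max (y.tendsto_dist z)).max (x.tendsto_dist z)).div
      (((x.tendsto_dist y).min (y.tendsto_dist z)).min (z.tendsto_dist x))
      (min_dist_pos hxy hyz hxz).ne'
  rw [Psi_eq_ofReal hxy hyz hxz]
  refine (ENNReal.tendsto_ofReal hquot).congr' ?_
  filter_upwards [eventually_val_ne hxy, eventually_val_ne hyz, eventually_val_ne hxz]
    with n hn₁ hn₂ hn₃
  have hr : 0 < r.seq n := r.pos n
  rw [Psi_eq_ofReal hn₁ hn₂ hn₃, Pi.div_apply, min_div_div_right hr.le, min_div_div_right hr.le,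
    max_div_div_right hr.le, max_div_div_right hr.le, div_div_div_cancel_right₀ hr.ne']

variable {l : Filter ℕ} {s₁ : ℝ}

theorem tendsto_sqRatio (hlim : LimitRelation p s₁) (hl : l ≤ atTop)
    (hord : ∀ᶠ n in l, (x.val n, y.val n, z.val n) ∈ orderedTriples X)
    (hxy : x.toSpace ≠ y.toSpace) (hyz : y.toSpace ≠ z.toSpace) (hxz : x.toSpace ≠ z.toSpace) :
    Tendsto (fun n => sqRatio s₁ (sExp (x.val n) (z.val n) (y.val n))) l (𝓝 ⊤) := by
  have htriple : Tendsto (fun n => (x.val n, y.val n, z.val n)) l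
      (𝓝[orderedTriples X] (p, p, p)) :=
    tendsto_nhdsWithin_iff.2 ⟨(x.tendsto_val.prodMk_nhds
      (y.tendsto_val.prodMk_nhds z.tendsto_val)).mono_left hl, hord⟩
  have hrel := Tendsto.comp hlim htriple
  exact tendsto_top_of_tendsto_mul_div hrel
    ((tendsto_Psi hxy hyz hxz).mono_left hl) (Psi_ne_top hxy hyz hxz)
    (ENNReal.tendsto_ofReal ((tendsto_Phi hxy hyz hxz).mono_left hl))
    (ENNReal.ofReal_pos.2 (Phi_pos hxy hyz hxz)).ne'

theorem rpow_add_rpow_eq [l.NeBot] (hlim : LimitRelation p s₁) (hl : l ≤ atTop)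
    (hord : ∀ᶠ n in l, (x.val n, y.val n, z.val n) ∈ orderedTriples X)
    (hxy : x.toSpace ≠ y.toSpace) (hyz : y.toSpace ≠ z.toSpace) (hxz : x.toSpace ≠ z.toSpace) :
    dist x.toSpace y.toSpace ^ s₁ + dist y.toSpace z.toSpace ^ s₁ =
      dist x.toSpace z.toSpace ^ s₁ := by
  have hsq := tendsto_sqRatio hlim hl hord hxy hyz hxz
  have tendsto_rpow {u v : F.Point} (huv : u.toSpace ≠ v.toSpace) :=
    ((u.tendsto_dist v).mono_left hl).rpow (tendsto_toReal_of_tendsto_sqRatio hsq)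
      (.inl (dist_pos.2 huv).ne')
  refine tendsto_nhds_unique (((tendsto_rpow hxy).add (tendsto_rpow hyz)).congr' ?_)
    (tendsto_rpow hxz)
  filter_upwards [eventually_ne_top_of_tendsto_sqRatio hsq] with n hn
  have hr : 0 ≤ r.seq n := (r.pos n).le
  rw [Real.div_rpow dist_nonneg hr, Real.div_rpow dist_nonneg hr, Real.div_rpow dist_nonneg hr,
    ← add_div, sExp_rpow_add_rpow hn]

theorem isLinearTriple_of_frequently (hlim : LimitRelation p s₁)
    (hxy : x.toSpace ≠ y.toSpace) (hyz : y.toSpace ≠ z.toSpace) (hxz : x.toSpace ≠ z.toSpace)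
    (hord : ∃ᶠ n in atTop, (x.val n, y.val n, z.val n) ∈ orderedTriples X) :
    IsLinearTriple (fun α β => dist α β ^ s₁) x.toSpace y.toSpace z.toSpace :=
  have := frequently_iff_neBot.1 hord
  .inl (rpow_add_rpow_eq hlim inf_le_left (mem_inf_of_right (mem_principal_self _)) hxy hyz hxz)

theorem isLinearTriple_of_ne (hs₁ : 0 < s₁) (hlim : LimitRelation p s₁)
    (hxy : x.toSpace ≠ y.toSpace) (hyz : y.toSpace ≠ z.toSpace) (hxz : x.toSpace ≠ z.toSpace) :
    IsLinearTriple (fun α β => dist α β ^ s₁) x.toSpace y.toSpace z.toSpace := by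
  have hD := isSemimetric_dist_rpow (Y := F.Space) hs₁
  have hperm := ((eventually_val_ne hxy).and ((eventually_val_ne hyz).and
    (eventually_val_ne hxz))).frequently.mono fun n hn =>
      exists_perm_mem_orderedTriples hn.1 hn.2.1 hn.2.2
  simp only [frequently_or_distrib] at hperm
  rcases hperm with h | h | h | h | h | h
  · exact isLinearTriple_of_frequently hlim hxy hyz hxz h
  · exact (isLinearTriple_of_frequently hlim hxz hyz.symm hxy h).swap_right hD
  · exact (isLinearTriple_of_frequently hlim hxy.symm hxz hyz h).swap_left hD
  · exact ((isLinearTriple_of_frequently hlim hyz hxz.symm hxy.symm h).swap_right hD).swap_left hD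
  · exact ((isLinearTriple_of_frequently hlim hxz.symm hxy hyz.symm h).swap_left hD).swap_right hD
  · exact (((isLinearTriple_of_frequently hlim hyz.symm hxy.symm hxz.symm h).swap_left
      hD).swap_right hD).swap_left hD

end Family.Point

end Convergence

section Tangent

variable {X : Type*} [MetricSpace X] {p : X} {r : NormalizingSequence} {s₁ : ℝ}

namespace Family

theorem isLinearTriple (F : Family p r) (hs₁ : 0 < s₁) (hlim : LimitRelation p s₁)
    (α β γ : F.Space) : IsLinearTriple (fun a b => dist a b ^ s₁) α β γ := by
  have hD := isSemimetric_dist_rpow (Y := F.Space) hs₁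
  by_cases hαβ : α = β
  · exact hαβ ▸ hD.isLinearTriple_self_left α γ
  by_cases hαγ : α = γ
  · exact (hαγ ▸ hD.isLinearTriple_self_left α β : IsLinearTriple _ α γ β).swap_right hD
  by_cases hβγ : β = γ
  · exact ((hβγ ▸ hD.isLinearTriple_self_left β α :
      IsLinearTriple _ β γ α).swap_right hD).swap_left hD
  obtain ⟨x, rfl⟩ := SeparationQuotient.surjective_mk α
  obtain ⟨y, rfl⟩ := SeparationQuotient.surjective_mk β
  obtain ⟨z, rfl⟩ := SeparationQuotient.surjective_mk γ
  exact Point.isLinearTriple_of_ne hs₁ hlim hαβ hβγ hαγ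

theorem exists_powIsometry_or_card_eq_four (F : Family p r) (hs₁ : 0 < s₁)
    (hlim : LimitRelation p s₁) :
    (∃ f : F.Space → ℝ, PowIsometry s₁ f) ∨ Nat.card F.Space = 4 :=
  (isSemimetric_dist_rpow hs₁).exists_abs_sub_eq_or_card_eq_four (F.isLinearTriple hs₁ hlim)

theorem isometry_emMap (F : Family p r) {φ : ℕ → ℕ} {hφ : StrictMono φ}
    (F' : Family p (r.subseq φ hφ)) (h : ∀ x ∈ F.carrier, x ∘ φ ∈ F'.carrier) :
    Isometry (F.emMap F' h) := by
  refine Isometry.of_dist_eq fun α β => ?_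
  obtain ⟨x, rfl⟩ := SeparationQuotient.surjective_mk α
  obtain ⟨y, rfl⟩ := SeparationQuotient.surjective_mk β
  exact (F.isometry_inMap F' h).dist_eq x y

end Family

variable {Y Z : Type*} [MetricSpace Y] [MetricSpace Z] {g : Y → Z} {s : ℝ}

theorem surjective_of_not_exists_powIsometry (hg : Isometry g)
    (hY : (∃ f : Y → ℝ, PowIsometry s f) ∨ Nat.card Y = 4)
    (hZ : (∃ f : Z → ℝ, PowIsometry s f) ∨ Nat.card Z = 4)
    (hno : ¬ ∃ f : Y → ℝ, PowIsometry s f) : Function.Surjective g := by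
  have hcardY := hY.resolve_left hno
  have hcardZ := hZ.resolve_left fun ⟨f, hf⟩ => hno ⟨f ∘ g, hf.comp_isometry hg⟩
  have : Finite Z := Nat.finite_of_card_ne_zero (by lia)
  exact (hg.injective.bijective_of_nat_card_le (by lia)).surjective

theorem surjective_of_surjective_powIsometry (hs : 0 < s) (hg : Isometry g)
    (hZ : (∃ f : Z → ℝ, PowIsometry s f) ∨ Nat.card Z = 4) {f : Y → ℝ} (hf : PowIsometry s f)
    (hsurj : Function.Surjective f) : Function.Surjective g := by
  have : Infinite Y := .of_surjective f hsurj
  have : Infinite Z := .of_injective g hg.injective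
  obtain ⟨k, hk⟩ := hZ.resolve_right (by simp)
  exact ((hf.surjective_of_surjective (hk.comp_isometry hg) hsurj).of_comp_left
    (hk.injective hs))

end Tangent

end Pretangent

theorem corollary3p4 {X : Type*} [MetricSpace X] (p : X) (hp : AccPt p (Filter.principal Set.univ))
    (r : Pretangent.NormalizingSequence) (F : Pretangent.Family p r)
    (s₁ : ℝ) (hs₁ : 0 < s₁) (hlim : Pretangent.LimitRelation p s₁) :
    ((¬ ∃ f : F.Space → ℝ, Pretangent.PowIsometry s₁ f) → F.IsTangent) ∧
    ((∃ f : F.Space → ℝ, Pretangent.PowIsometry s₁ f ∧ Function.Surjective f) → F.IsTangent) := by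
  have dichotomy {r' : Pretangent.NormalizingSequence} (G : Pretangent.Family p r') :=
    G.exists_powIsometry_or_card_eq_four hs₁ hlim
  refine ⟨fun hno φ hφ F' hF' => ?_, fun ⟨f, hf, hsurj⟩ φ hφ F' hF' => ?_⟩
  · have hiso := F.isometry_emMap F' hF'
    exact ⟨hiso, Pretangent.surjective_of_not_exists_powIsometry hiso (dichotomy F)
      (dichotomy F') hno⟩
  · have hiso := F.isometry_emMap F' hF'
    exact ⟨hiso, Pretangent.surjective_of_surjective_powIsometry hs₁ hiso (dichotomy F') hf hsurj⟩
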